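/- Terms of the $\lambda\mathtt{x}$-calculus are $t ::= x \mid (t\ t) \mid \lambda x.t \mid t[t/x]$, where $\lambda x.t$ and $t[u/x]$ bind $x$ in $t$, taken modulo $\alpha$-conversion. One-step reduction $\to$ is the closure under all contexts, modulo $\alpha$-conversion, of the rules $$(\lambda x.t)\,u \to_{\mathit{Beta}} t[u/x],\qquad (t\ u)[v/x] \to_{\mathit{App}} (t[v/x])\ (u[v/x]),\qquad (\lambda x.t)[u/y] \to_{\mathit{Lambda}} \lambda x.(t[u/y]),$$ $$x[t/x] \to_{\mathit{Var1}} t,\qquad y[t/x] \to_{\mathit{Var2}} y,$$ where $x\neq y$ in $\mathit{Lambda}$ and $\mathit{Var2}$, and $x\notin \mathrm{FV}(u)$ in $\mathit{Lambda}$. A term is pure if it contains no explicit substitution $t[u/x]$, and strongly normalizing if no infinite sequence of reductions starts from it. Simple types are built from atomic types with $\to$, and the typing rules are $$\frac{}{\Gamma,x:A\vdash x:A}\qquad \frac{\Gamma\vdash t:B\to A\quad \Gamma\vdash u:B}{\Gamma\vdash (t\ u):A}\qquad \frac{\Gamma,x:B\vdash t:A}{\Gamma\vdash\lambda x.t:B\to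 A}\qquad \frac{\Gamma\vdash u:B\quad \Gamma,x:B\vdash t:A}{\Gamma\vdash t[u/x]:A}.$$ Define $\mathit{Ateb}(x)=x$, $\mathit{Ateb}(t\ u)=\mathit{Ateb}(t)\ \mathit{Ateb}(u)$, $\mathit{Ateb}(\lambda x.t)=\lambda x.\mathit{Ateb}(t)$ and $\mathit{Ateb}(t[u/x])=(\lambda x.\mathit{Ateb}(t))\ \mathit{Ateb}(u)$. Then: 1. for every term $t$, the term $\mathit{Ateb}(t)$ is pure; 2. if $\Gamma\vdash t:A$, then $\Gamma\vdash \mathit{Ateb}(t):A$; 3. for every term $t$, $\mathit{Ateb}(t)\to^*_{\mathit{Beta}} t$; 4. every simply typed term of the $\lambda\mathtt{x}$-calculus is strongly normalizing: if $\Gamma\vdash t:A$, then $t$ is strongly normalizing. -/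

import Mathlib

namespace LambdaX

/-- Raw terms of the calculus with explicit substitutions, over the countably infinite set `ℕ` of
variable names: `t ::= x | t t | λx.t | t[u/x]`.  The term `t[u/x]` is `sub t x u`; it binds `x`
in `t` (and not in `u`). -/
inductive Term : Type
  | var (x : ℕ) : Term
  | app (t u : Term) : Term
  | lam (x : ℕ) (t : Term) : Term
  | sub (t : Term) (x : ℕ) (u : Term) : Term

namespace Term

/-- Free variables. -/
def fv : Term → Finset ℕ
  | var x => {x}
  | app t u => fv t ∪ fv u
  | lam x t => (fv t).erase x
  | sub t x u => (fv t).erase x ∪ fv u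

/-- Exchange the names `a` and `b` everywhere in a term, at binders too. -/
def swap (a b : ℕ) : Term → Term
  | var x => var (Equiv.swap a b x)
  | app t u => app (swap a b t) (swap a b u)
  | lam x t => lam (Equiv.swap a b x) (swap a b t)
  | sub t x u => sub (swap a b t) (Equiv.swap a b x) (swap a b u)

/-- Pure terms, that is, terms of the λ-calculus: no explicit substitution occurs in them. -/
def IsPure : Term → Prop
  | var _ => True
  | app t u => IsPure t ∧ IsPure u
  | lam _ t => IsPure t
  | sub _ _ _ => False

/-- The expansion of every `t[u/x]` into the redex `(λx.t) u`. -/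
def ateb : Term → Term
  | var x => var x
  | app t u => app (ateb t) (ateb u)
  | lam x t => lam x (ateb t)
  | sub t x u => app (lam x (ateb t)) (ateb u)

end Term

open Term

/-- α-conversion: the least congruence that allows the renaming of a bound variable `x` into any
`y` that is not free in the scope of the binder (the names `x` and `y` are exchanged there, so
that no capture can occur). -/
inductive AlphaEq : Term → Term → Prop
  | lam_rename (x y : ℕ) (t : Term) (h : y ∉ fv t) :
      AlphaEq (lam x t) (lam y (swap x y t))
  | sub_rename (x y : ℕ) (t u : Term) (h : y ∉ fv t) :
      AlphaEq (sub t x u) (sub (swap x y t) y u)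
  | refl (t : Term) : AlphaEq t t
  | symm {t u : Term} : AlphaEq t u → AlphaEq u t
  | trans {t u v : Term} : AlphaEq t u → AlphaEq u v → AlphaEq t v
  | app {t t' u u' : Term} : AlphaEq t t' → AlphaEq u u' → AlphaEq (app t u) (app t' u')
  | lam (x : ℕ) {t t' : Term} : AlphaEq t t' → AlphaEq (lam x t) (lam x t')
  | sub (x : ℕ) {t t' u u' : Term} :
      AlphaEq t t' → AlphaEq u u' → AlphaEq (sub t x u) (sub t' x u')

/-- The rule Beta, at the root. -/
inductive BetaRule : Term → Term → Prop
  | beta (x : ℕ) (t u : Term) : BetaRule (app (lam x t) u) (sub t x u)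

/-- The five rules of the calculus, at the root.  In the rule Lambda the bound variable `x` is
distinct from `y` and not free in `u`; α-conversion makes the rule applicable to every term
`(λx.t)[u/y]`. -/
inductive Rule : Term → Term → Prop
  | beta {t u : Term} : BetaRule t u → Rule t u
  | app (t u : Term) (x : ℕ) (v : Term) :
      Rule (sub (app t u) x v) (app (sub t x v) (sub u x v))
  | lam (x : ℕ) (t : Term) (y : ℕ) (u : Term) (hxy : x ≠ y) (hx : x ∉ fv u) :
      Rule (sub (lam x t) y u) (lam x (sub t y u))
  | var1 (x : ℕ) (t : Term) : Rule (sub (var x) x t) t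
  | var2 (x y : ℕ) (t : Term) (hxy : y ≠ x) : Rule (sub (var y) x t) (var y)

/-- Contextual closure: one application of `R` to a subterm at any position. -/
inductive Compat (R : Term → Term → Prop) : Term → Term → Prop
  | root {t t' : Term} : R t t' → Compat R t t'
  | app_left {t t' : Term} (u : Term) : Compat R t t' → Compat R (app t u) (app t' u)
  | app_right (t : Term) {u u' : Term} : Compat R u u' → Compat R (app t u) (app t u')
  | lam (x : ℕ) {t t' : Term} : Compat R t t' → Compat R (lam x t) (lam x t')
  | sub_left {t t' : Term} (x : ℕ) (u : Term) : Compat R t t' → Compat R (sub t x u) (sub t' x u)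
  | sub_right (t : Term) (x : ℕ) {u u' : Term} :
      Compat R u u' → Compat R (sub t x u) (sub t x u')

/-- One-step reduction by `R` in any context, modulo α-conversion. -/
def RedOf (R : Term → Term → Prop) (t t' : Term) : Prop :=
  ∃ s s', AlphaEq t s ∧ Compat R s s' ∧ AlphaEq s' t'

/-- One-step reduction of the calculus. -/
def Red : Term → Term → Prop := RedOf Rule

/-- One-step reduction by the rule Beta alone. -/
def BetaRed : Term → Term → Prop := RedOf BetaRule

/-- Strong normalization: there is no infinite reduction sequence starting from `t`. -/
def SN (t : Term) : Prop :=
  ¬ ∃ f : ℕ → Term, f 0 = t ∧ ∀ n, Red (f n) (f (n + 1))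

/-- Simple types, over countably many atomic types. -/
inductive SimpleType : Type
  | atom (n : ℕ) : SimpleType
  | arrow (A B : SimpleType) : SimpleType

/-- Typing contexts: partial assignments of types to variables. -/
abbrev Context : Type := ℕ → Option SimpleType

/-- The context `Γ, x : A`. -/
def Context.extend (Γ : Context) (x : ℕ) (A : SimpleType) : Context :=
  Function.update Γ x (some A)

/-- The simple typing judgment `Γ ⊢ t : A`.  On pure terms, to which the rule `sub` does not apply,
it is the judgment of the simply typed λ-calculus. -/
inductive Typing : Context → Term → SimpleType → Prop
  | var {Γ : Context} {x : ℕ} {A : SimpleType} (h : Γ x = some A) : Typing Γ (var x) A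
  | app {Γ : Context} {t u : Term} {A B : SimpleType} :
      Typing Γ t (SimpleType.arrow B A) → Typing Γ u B → Typing Γ (app t u) A
  | lam {Γ : Context} {x : ℕ} {t : Term} {A B : SimpleType} :
      Typing (Γ.extend x B) t A → Typing Γ (lam x t) (SimpleType.arrow B A)
  | sub {Γ : Context} {t : Term} {x : ℕ} {u : Term} {A B : SimpleType} :
      Typing Γ u B → Typing (Γ.extend x B) t A → Typing Γ (sub t x u) A

end LambdaX

/-! Claims 1 to 3 are structural inductions: `ateb` turns a closure into a typable redex, and one
Beta step at the root turns that redex back into the closure.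

Strong normalization is proved by Tait's reducibility method on nameless terms, since
`Red.toDB_step` maps each named step to exactly one nameless step. Reducibility must be stable under
two expansions in head position: from `t[u]` to `(λt) u`, which is easy (`BetaExp.sn`), and from the
performed substitution `inst u t` to the explicit `t[u]`, for `u` strongly normalizing
(`HeadExp.sn`).

The second expansion is the heart of the proof. The closure is marked, and its descendants are
followed along a reduction. Each step either is matched by at least one step once the marked
substitutions are performed, or leaves that unfolding unchanged and only propagates a mark or
reduces a term that it substitutes (`exists_progress`). Steps of the latter kind terminate, because
bodies of marked closures shrink and the substituted terms are strongly normalizing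
(`Good.adminSN`). A lexicographic induction concludes (`Good.sn_erase`). -/

namespace LambdaX

/-! ### A nameless version of the calculus, with garbage collection -/

/-- Terms with de Bruijn indices; `lam` and the first argument of `sub` bind the index `0`. -/
inductive DB : Type
  | var (n : ℕ) : DB
  | app (t u : DB) : DB
  | lam (t : DB) : DB
  | sub (t u : DB) : DB

namespace DB

/-- Lift a renaming under a binder. -/
def up (f : ℕ → ℕ) : ℕ → ℕ
  | 0 => 0
  | n + 1 => f n + 1

/-- Exchange of the two innermost indices. -/
def sw : ℕ → ℕ
  | 0 => 1
  | 1 => 0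
  | n + 2 => n + 2

def rename (f : ℕ → ℕ) : DB → DB
  | var n => var (f n)
  | app t u => app (rename f t) (rename f u)
  | lam t => lam (rename (up f) t)
  | sub t u => sub (rename (up f) t) (rename f u)

/-- Lift a substitution under a binder. -/
def ups (σ : ℕ → DB) : ℕ → DB
  | 0 => var 0
  | n + 1 => rename Nat.succ (σ n)

/-- Simultaneous capture-avoiding substitution. -/
def subst (σ : ℕ → DB) : DB → DB
  | var n => σ n
  | app t u => app (subst σ t) (subst σ u)
  | lam t => lam (subst (ups σ) t)
  | sub t u => sub (subst (ups σ) t) (subst σ u)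

/-- The substitution `0 ↦ u`, `n + 1 ↦ σ n`. -/
def cons (u : DB) (σ : ℕ → DB) : ℕ → DB
  | 0 => u
  | n + 1 => σ n

/-- Substitution for the index `0`. -/
def inst (u t : DB) : DB := subst (cons u var) t

def size : DB → ℕ
  | var _ => 0
  | app t u => size t + size u + 1
  | lam t => size t + 1
  | sub t u => size t + size u + 1

/-! ### Algebra of renamings and substitutions -/

theorem size_rename (f : ℕ → ℕ) (t : DB) : size (rename f t) = size t := by
  induction t generalizing f <;> simp_all [rename, size]

theorem up_comp (f g : ℕ → ℕ) : up f ∘ up g = up (f ∘ g) := by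
  funext n; cases n <;> rfl

theorem rename_rename (f g : ℕ → ℕ) (t : DB) : rename f (rename g t) = rename (f ∘ g) t := by
  induction t generalizing f g <;> simp_all [rename, up_comp]

theorem up_id : up id = id := by funext n; cases n <;> rfl

theorem rename_id (t : DB) : rename id t = t := by
  induction t <;> simp_all [rename, up_id]

theorem ups_comp_up (σ : ℕ → DB) (f : ℕ → ℕ) : ups σ ∘ up f = ups (σ ∘ f) := by
  funext n; cases n <;> rfl

theorem subst_rename (σ : ℕ → DB) (f : ℕ → ℕ) (t : DB) :
    subst σ (rename f t) = subst (σ ∘ f) t := by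
  induction t generalizing σ f <;> simp_all [rename, subst, ups_comp_up]

theorem rename_comp_ups (σ : ℕ → DB) (f : ℕ → ℕ) :
    rename (up f) ∘ ups σ = ups (rename f ∘ σ) := by
  funext n
  cases n with
  | zero => rfl
  | succ n =>
    simp only [Function.comp, ups, rename_rename]
    rfl

theorem rename_subst (σ : ℕ → DB) (f : ℕ → ℕ) (t : DB) :
    rename f (subst σ t) = subst (rename f ∘ σ) t := by
  induction t generalizing σ f <;> simp_all [rename, subst, rename_comp_ups]

theorem subst_comp_ups (σ τ : ℕ → DB) : subst (ups σ) ∘ ups τ = ups (subst σ ∘ τ) := by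
  funext n
  cases n with
  | zero => rfl
  | succ n =>
    simp only [Function.comp, ups, subst_rename, rename_subst]
    rfl

theorem subst_subst (σ τ : ℕ → DB) (t : DB) : subst σ (subst τ t) = subst (subst σ ∘ τ) t := by
  induction t generalizing σ τ <;> simp_all [subst, subst_comp_ups]

theorem ups_var_comp (f : ℕ → ℕ) : ups (var ∘ f) = var ∘ up f := by
  funext n; cases n <;> rfl

theorem rename_eq_subst (f : ℕ → ℕ) (t : DB) : rename f t = subst (var ∘ f) t := by
  induction t generalizing f <;> simp_all [rename, subst, ups_var_comp]

theorem subst_var (t : DB) : subst var t = t := by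
  rw [← rename_id t, subst_rename, ← rename_eq_subst]

theorem inst_subst_ups (u : DB) (σ : ℕ → DB) (t : DB) :
    inst u (subst (ups σ) t) = subst (cons u σ) t := by
  rw [inst, subst_subst]
  congr 1
  funext n
  cases n with
  | zero => rfl
  | succ n =>
    simp only [Function.comp, ups, subst_rename, cons]
    exact subst_var _

theorem inst_rename_up (f : ℕ → ℕ) (u t : DB) :
    inst (rename f u) (rename (up f) t) = rename f (inst u t) := by
  rw [inst, inst, subst_rename, rename_subst]
  congr 1
  funext n
  cases n <;> rfl

theorem inst_shift (u t : DB) : inst u (rename Nat.succ t) = t := by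
  rw [inst, subst_rename]
  exact subst_var t

/-- Pushing a marked closure under an abstraction therefore does not change its unfolding. -/
theorem inst_sw (u t : DB) :
    inst (rename Nat.succ u) (rename sw t) = subst (ups (cons u var)) t := by
  rw [inst, subst_rename]
  congr 1
  funext n
  match n with
  | 0 => rfl
  | 1 => rfl
  | n + 2 => rfl

end DB

/-! ### Nameless reduction and its stability under substitution -/

open DB

/-- One-step reduction of nameless terms.  The rule `gc` erases a substitution for a variable that
does not occur. -/
inductive Step : DB → DB → Prop
  | beta (t u : DB) : Step (.app (.lam t) u) (.sub t u)
  | app (t u v : DB) : Step (.sub (.app t u) v) (.app (.sub t v) (.sub u v))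
  | lam (t u : DB) :
      Step (.sub (.lam t) u) (.lam (.sub (rename sw t) (rename Nat.succ u)))
  | var1 (u : DB) : Step (.sub (.var 0) u) u
  | gc (t u : DB) : Step (.sub (rename Nat.succ t) u) t
  | app_left {t t' : DB} (u : DB) : Step t t' → Step (.app t u) (.app t' u)
  | app_right (t : DB) {u u' : DB} : Step u u' → Step (.app t u) (.app t u')
  | lam_congr {t t' : DB} : Step t t' → Step (.lam t) (.lam t')
  | sub_left {t t' : DB} (u : DB) : Step t t' → Step (.sub t u) (.sub t' u)
  | sub_right (t : DB) {u u' : DB} : Step u u' → Step (.sub t u) (.sub t u')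

/-- Strong normalization of nameless terms, as accessibility. -/
def DB.SN (t : DB) : Prop := Acc (fun a b => Step b a) t

theorem DB.SN.step {t t' : DB} (h : t.SN) (s : Step t t') : t'.SN := h.inv s

/-- This stability is what forces `gc` to cover all shifted terms: an instance of Var2 becomes, once
its surviving variable is replaced by a term, an erasure in front of that term. -/
theorem Step.subst {t t' : DB} (h : Step t t') (σ : ℕ → DB) :
    Step (DB.subst σ t) (DB.subst σ t') := by
  induction h generalizing σ with
  | beta t u => exact .beta _ _
  | app t u v => exact .app _ _ _
  | lam t u =>
    have h := Step.lam (DB.subst (ups (ups σ)) t) (DB.subst σ u)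
    simp only [DB.subst, subst_rename, rename_subst] at h ⊢
    convert h using 4
    · funext n
      match n with
      | 0 => rfl
      | 1 => rfl
      | n + 2 =>
        simp only [Function.comp, sw, ups, rename_rename]
        rfl
    · rfl
  | var1 u => exact .var1 _
  | gc t u =>
    have h := Step.gc (DB.subst σ t) (DB.subst σ u)
    simp only [DB.subst, subst_rename, rename_subst] at h ⊢
    exact h
  | app_left u _ ih => exact .app_left _ (ih σ)
  | app_right t _ ih => exact .app_right _ (ih σ)
  | lam_congr _ ih => exact .lam_congr (ih _)
  | sub_left u _ ih => exact .sub_left _ (ih _)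
  | sub_right t _ ih => exact .sub_right _ (ih _)

theorem Step.rename {t t' : DB} (h : Step t t') (f : ℕ → ℕ) :
    Step (DB.rename f t) (DB.rename f t') := by
  rw [rename_eq_subst, rename_eq_subst]
  exact h.subst _

/-- A map on terms that preserves steps reflects strong normalization. -/
theorem DB.SN.of_map {F : DB → DB} (hF : ∀ t t', Step t t' → Step (F t) (F t')) {t : DB}
    (h : (F t).SN) : t.SN :=
  Subrelation.accessible (r := InvImage (fun a b => Step b a) F) (fun {_ _} s => hF _ _ s)
    (InvImage.accessible F h)

theorem DB.SN.of_rename {f : ℕ → ℕ} {t : DB} (h : (DB.rename f t).SN) : t.SN :=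
  DB.SN.of_map (fun _ _ s => s.rename f) h

theorem DB.SN.shift {t : DB} (h : t.SN) : (DB.rename Nat.succ t).SN := by
  apply DB.SN.of_rename (f := Nat.pred)
  rw [rename_rename]
  exact (rename_id t).symm ▸ h

open Relation

theorem reflTransGen_map {α β : Type*} {r : α → α → Prop} {p : β → β → Prop} (f : α → β)
    (hf : ∀ a b, r a b → p (f a) (f b)) {a b : α} (h : ReflTransGen r a b) :
    ReflTransGen p (f a) (f b) :=
  ReflTransGen.lift f (fun _ _ s => hf _ _ s) _ _ h

/-- Reduction in any number of steps. -/
abbrev Steps : DB → DB → Prop := ReflTransGen Step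

theorem Steps.app {t t' u u' : DB} (h : Steps t t') (k : Steps u u') :
    Steps (.app t u) (.app t' u') :=
  (reflTransGen_map (fun x => DB.app x u) (fun _ _ s => .app_left _ s) h).trans
    (reflTransGen_map (DB.app t') (fun _ _ s => .app_right _ s) k)

theorem Steps.sub {t t' u u' : DB} (h : Steps t t') (k : Steps u u') :
    Steps (.sub t u) (.sub t' u') :=
  (reflTransGen_map (fun x => DB.sub x u) (fun _ _ s => .sub_left _ s) h).trans
    (reflTransGen_map (DB.sub t') (fun _ _ s => .sub_right _ s) k)

theorem Steps.ups {σ τ : ℕ → DB} (h : ∀ n, Steps (σ n) (τ n)) (n : ℕ) :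
    Steps (DB.ups σ n) (DB.ups τ n) := by
  cases n with
  | zero => exact .refl
  | succ n => exact reflTransGen_map (DB.rename Nat.succ) (fun _ _ s => s.rename _) (h n)

theorem Steps.subst_congr {σ τ : ℕ → DB} (h : ∀ n, Steps (σ n) (τ n)) (t : DB) :
    Steps (DB.subst σ t) (DB.subst τ t) := by
  induction t generalizing σ τ with
  | var n => exact h n
  | app t u iht ihu => exact (iht h).app (ihu h)
  | lam t ih => exact reflTransGen_map DB.lam (fun _ _ s => .lam_congr s) (ih (Steps.ups h))
  | sub t u iht ihu => exact (iht (Steps.ups h)).sub (ihu h)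

/-- One step of `u` is repeated at each occurrence of the index `0`, so the number of steps may be
zero. -/
theorem Steps.inst_congr {u u' : DB} (h : Step u u') (t : DB) :
    Steps (inst u t) (inst u' t) := by
  apply Steps.subst_congr
  intro n
  cases n with
  | zero => exact .single h
  | succ n => exact .refl

/-! ### Terms in which some explicit substitutions are marked -/

/-- Terms with marked closures `clo t v`, to be read as `t[v/0]`. -/
inductive Marked : Type
  | var (n : ℕ) : Marked
  | app (M N : Marked) : Marked
  | lam (M : Marked) : Marked
  | sub (M N : Marked) : Marked
  | clo (t v : DB) : Marked

namespace Marked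

/-- Forget the marks. -/
def erase : Marked → DB
  | var n => .var n
  | app M N => .app (erase M) (erase N)
  | lam M => .lam (erase M)
  | sub M N => .sub (erase M) (erase N)
  | clo t v => .sub t v

/-- Perform the marked substitutions. -/
def unfold : Marked → DB
  | var n => .var n
  | app M N => .app (unfold M) (unfold N)
  | lam M => .lam (unfold M)
  | sub M N => .sub (unfold M) (unfold N)
  | clo t v => inst v t

def rename (f : ℕ → ℕ) : Marked → Marked
  | var n => var (f n)
  | app M N => app (rename f M) (rename f N)
  | lam M => lam (rename (up f) M)
  | sub M N => sub (rename (up f) M) (rename f N)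
  | clo t v => clo (t.rename (up f)) (v.rename f)

/-- A term without marks. -/
def ofDB : DB → Marked
  | .var n => var n
  | .app t u => app (ofDB t) (ofDB u)
  | .lam t => lam (ofDB t)
  | .sub t u => sub (ofDB t) (ofDB u)

/-- Every term substituted by a marked closure is strongly normalizing. -/
def Good : Marked → Prop
  | var _ => True
  | app M N => Good M ∧ Good N
  | lam M => Good M
  | sub M N => Good M ∧ Good N
  | clo _ v => v.SN

theorem erase_rename (f : ℕ → ℕ) (M : Marked) :
    (M.rename f).erase = M.erase.rename f := by
  induction M generalizing f <;> simp_all [rename, erase, DB.rename]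

theorem unfold_rename (f : ℕ → ℕ) (M : Marked) :
    (M.rename f).unfold = M.unfold.rename f := by
  induction M generalizing f <;> simp_all [rename, unfold, DB.rename, inst_rename_up]

theorem erase_ofDB (t : DB) : (ofDB t).erase = t := by
  induction t <;> simp_all [ofDB, erase]

theorem unfold_ofDB (t : DB) : (ofDB t).unfold = t := by
  induction t <;> simp_all [ofDB, unfold]

theorem good_ofDB (t : DB) : (ofDB t).Good := by
  induction t <;> simp_all [ofDB, Good]

theorem Good.of_rename {f : ℕ → ℕ} {M : Marked} (h : (M.rename f).Good) : M.Good := by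
  induction M generalizing f with
  | var n => trivial
  | app M N ihM ihN => exact ⟨ihM h.1, ihN h.2⟩
  | lam M ih => exact ih (f := up f) h
  | sub M N ihM ihN => exact ⟨ihM h.1, ihN h.2⟩
  | clo t v => exact DB.SN.of_rename h

/-- Renamings with a left inverse preserve goodness. -/
theorem Good.rename {f g : ℕ → ℕ} (hgf : g ∘ f = id) {M : Marked} (h : M.Good) :
    (M.rename f).Good := by
  induction M generalizing f g with
  | var n => trivial
  | app M N ihM ihN => exact ⟨ihM hgf h.1, ihN hgf h.2⟩
  | lam M ih => exact ih (g := up g) (by rw [up_comp, hgf, up_id]) h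
  | sub M N ihM ihN =>
    exact ⟨ihM (g := up g) (by rw [up_comp, hgf, up_id]) h.1, ihN hgf h.2⟩
  | clo t v =>
    apply DB.SN.of_rename (f := g)
    rw [rename_rename, hgf, rename_id]
    exact h

theorem sw_comp_sw : sw ∘ sw = id := by
  funext n
  match n with
  | 0 => rfl
  | 1 => rfl
  | n + 2 => rfl

/-- Marks do not hinder strengthening: this lets `gc` act on an unmarked closure whose body contains
marks. -/
theorem eq_rename_of_erase_eq {f : ℕ → ℕ} {M : Marked} {t : DB} (h : M.erase = t.rename f) :
    ∃ M' : Marked, M = M'.rename f ∧ M'.erase = t := by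
  induction t generalizing f M with
  | var n =>
    cases M <;> simp [erase, DB.rename] at h
    exact ⟨.var n, by simp [rename, h], rfl⟩
  | app t u iht ihu =>
    cases M <;> simp [erase, DB.rename] at h
    obtain ⟨M', rfl, hM⟩ := iht h.1
    obtain ⟨N', rfl, hN⟩ := ihu h.2
    exact ⟨.app M' N', rfl, by simp [erase, hM, hN]⟩
  | lam t ih =>
    cases M <;> simp [erase, DB.rename] at h
    obtain ⟨M', rfl, hM⟩ := ih h
    exact ⟨.lam M', rfl, by simp [erase, hM]⟩
  | sub t u iht ihu =>
    cases M <;> simp [erase, DB.rename] at h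
    · obtain ⟨M', rfl, hM⟩ := iht h.1
      obtain ⟨N', rfl, hN⟩ := ihu h.2
      exact ⟨.sub M' N', rfl, by simp [erase, hM, hN]⟩
    · exact ⟨.clo t u, by simp [rename, h.1, h.2], rfl⟩

/-- Propagation of marked closures, and reduction of the terms they substitute. -/
inductive Admin : Marked → Marked → Prop
  | app (t u v : DB) : Admin (clo (.app t u) v) (.app (clo t v) (clo u v))
  | lam (t v : DB) :
      Admin (clo (.lam t) v) (.lam (clo (t.rename sw) (v.rename Nat.succ)))
  | var1 (v : DB) : Admin (clo (.var 0) v) (ofDB v)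
  | gc (t v : DB) : Admin (clo (t.rename Nat.succ) v) (ofDB t)
  | clo_right (t : DB) {v v' : DB} : Step v v' → Admin (clo t v) (clo t v')
  | app_left {M M' : Marked} (N : Marked) : Admin M M' → Admin (.app M N) (.app M' N)
  | app_right (M : Marked) {N N' : Marked} : Admin N N' → Admin (.app M N) (.app M N')
  | lam_congr {M M' : Marked} : Admin M M' → Admin (.lam M) (.lam M')
  | sub_left {M M' : Marked} (N : Marked) : Admin M M' → Admin (.sub M N) (.sub M' N)
  | sub_right (M : Marked) {N N' : Marked} : Admin N N' → Admin (.sub M N) (.sub M N')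

/-- Strong normalization for `Admin`. -/
def AdminSN (M : Marked) : Prop := Acc (fun a b => Admin b a) M

theorem AdminSN.var (n : ℕ) : AdminSN (.var n) := ⟨_, fun _ h => nomatch h⟩

theorem AdminSN.app {M N : Marked} (hM : AdminSN M) (hN : AdminSN N) : AdminSN (.app M N) := by
  induction hM generalizing N with
  | intro M hM ihM =>
    induction hN with
    | intro N hN ihN =>
      refine ⟨_, fun P h => ?_⟩
      cases h with
      | app_left _ h => exact ihM _ h ⟨_, hN⟩
      | app_right _ h => exact ihN _ h

theorem AdminSN.sub {M N : Marked} (hM : AdminSN M) (hN : AdminSN N) : AdminSN (.sub M N) := by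
  induction hM generalizing N with
  | intro M hM ihM =>
    induction hN with
    | intro N hN ihN =>
      refine ⟨_, fun P h => ?_⟩
      cases h with
      | sub_left _ h => exact ihM _ h ⟨_, hN⟩
      | sub_right _ h => exact ihN _ h

theorem AdminSN.lam {M : Marked} (hM : AdminSN M) : AdminSN (.lam M) := by
  induction hM with
  | intro M hM ihM =>
    refine ⟨_, fun P h => ?_⟩
    cases h with
    | lam_congr h => exact ihM _ h

theorem AdminSN.ofDB (t : DB) : AdminSN (ofDB t) := by
  induction t with
  | var n => exact .var n
  | app t u iht ihu => exact .app iht ihu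
  | lam t ih => exact .lam ih
  | sub t u iht ihu => exact .sub iht ihu

/-- Outer induction on a bound for the size of the body, which propagation decreases; inner
induction on the reductions of `v`, which keep the body. The terms released by `var1` and `gc` carry
no marks, hence are inert. -/
theorem AdminSN.clo (n : ℕ) : ∀ (t v : DB), t.size < n → v.SN → AdminSN (.clo t v) := by
  induction n with
  | zero => intro t v h; omega
  | succ n ih =>
    intro t v ht hv
    induction hv with
    | intro v hv ihv =>
      have hv' : v.SN := ⟨_, hv⟩
      refine ⟨_, fun P h => ?_⟩
      cases h with
      | app t u v =>
        simp only [size] at ht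
        exact AdminSN.app (ih _ _ (by omega) hv') (ih _ _ (by omega) hv')
      | lam t v =>
        simp only [size] at ht
        exact AdminSN.lam (ih _ _ (by rw [size_rename]; omega) hv'.shift)
      | var1 v => exact AdminSN.ofDB _
      | gc t v => exact AdminSN.ofDB _
      | clo_right t h => exact ihv _ h

theorem Good.adminSN {M : Marked} (h : M.Good) : AdminSN M := by
  induction M with
  | var n => exact .var n
  | app M N ihM ihN => exact .app (ihM h.1) (ihN h.2)
  | lam M ih => exact .lam (ih h)
  | sub M N ihM ihN => exact .sub (ihM h.1) (ihN h.2)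
  | clo t v => exact .clo _ t v (Nat.lt_succ_self _) h

/-- Either the unfolding makes at least one step, or it is unchanged and the marked term makes an
administrative step. -/
def Progress (M M' : Marked) : Prop :=
  TransGen Step M.unfold M'.unfold ∨ (M.unfold = M'.unfold ∧ Admin M M')

theorem Progress.congr {M M' : Marked} (h : Progress M M') (F : DB → DB) (G : Marked → Marked)
    (hFG : ∀ P, (G P).unfold = F P.unfold) (hF : ∀ t t', Step t t' → Step (F t) (F t'))
    (hG : Admin M M' → Admin (G M) (G M')) : Progress (G M) (G M') := by
  rcases h with h | ⟨h, h'⟩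
  · left
    rw [hFG, hFG]
    exact TransGen.lift F (fun _ _ s => hF _ _ s) _ _ h
  · exact .inr ⟨by rw [hFG, hFG, h], hG h'⟩

/-- Every step of a term with good marks can be followed on the marks. -/
theorem exists_progress {M : Marked} {t' : DB} (h : Step M.erase t') (hM : M.Good) :
    ∃ M' : Marked, M'.erase = t' ∧ M'.Good ∧ Progress M M' := by
  induction M generalizing t' with
  | var n => nomatch h
  | app M N ihM ihN =>
    generalize hMe : M.erase = a at *
    simp only [erase, hMe] at h
    cases h with
    | beta t u =>
      cases M <;> simp [erase] at hMe
      subst hMe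
      exact ⟨.sub _ N, rfl, hM, .inl (.single (.beta _ _))⟩
    | app_left u h =>
      obtain ⟨M', rfl, hg, hp⟩ := ihM h hM.1
      exact ⟨.app M' N, rfl, ⟨hg, hM.2⟩, hp.congr (fun x => .app x N.unfold) (fun P => .app P N)
        (fun _ => rfl) (fun _ _ s => .app_left _ s) (.app_left _)⟩
    | app_right t h =>
      obtain ⟨N', rfl, hg, hp⟩ := ihN h hM.2
      exact ⟨.app M N', by simp [erase, hMe], ⟨hM.1, hg⟩, hp.congr (.app M.unfold) (.app M)
        (fun _ => rfl) (fun _ _ s => .app_right _ s) (.app_right _)⟩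
  | lam M ih =>
    cases h with
    | lam_congr h =>
      obtain ⟨M', rfl, hg, hp⟩ := ih h hM
      exact ⟨.lam M', rfl, hg, hp.congr .lam .lam (fun _ => rfl) (fun _ _ s => .lam_congr s)
        .lam_congr⟩
  | sub M N ihM ihN =>
    generalize hMe : M.erase = a at *
    simp only [erase, hMe] at h
    cases h with
    | app t u v =>
      cases M <;> simp [erase] at hMe
      obtain ⟨rfl, rfl⟩ := hMe
      exact ⟨.app (.sub _ N) (.sub _ N), rfl, ⟨⟨hM.1.1, hM.2⟩, ⟨hM.1.2, hM.2⟩⟩,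
        .inl (.single (.app _ _ _))⟩
    | lam t u =>
      cases M <;> simp [erase] at hMe
      subst hMe
      rename_i M
      refine ⟨.lam (.sub (M.rename sw) (N.rename Nat.succ)), by simp [erase, erase_rename],
        ⟨Good.rename sw_comp_sw hM.1, Good.rename (g := Nat.pred) rfl hM.2⟩, .inl (.single ?_)⟩
      simp only [unfold, unfold_rename]
      exact .lam _ _
    | var1 u =>
      cases M <;> simp [erase] at hMe
      subst hMe
      exact ⟨N, rfl, hM.2, .inl (.single (.var1 _))⟩
    | gc t u =>
      obtain ⟨M', rfl, rfl⟩ := eq_rename_of_erase_eq hMe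
      refine ⟨M', rfl, hM.1.of_rename, .inl (.single ?_)⟩
      simp only [unfold, unfold_rename]
      exact .gc _ _
    | sub_left u h =>
      obtain ⟨M', rfl, hg, hp⟩ := ihM h hM.1
      exact ⟨.sub M' N, rfl, ⟨hg, hM.2⟩, hp.congr (fun x => .sub x N.unfold) (fun P => .sub P N)
        (fun _ => rfl) (fun _ _ s => .sub_left _ s) (.sub_left _)⟩
    | sub_right t h =>
      obtain ⟨N', rfl, hg, hp⟩ := ihN h hM.2
      exact ⟨.sub M N', by simp [erase, hMe], ⟨hM.1, hg⟩, hp.congr (.sub M.unfold) (.sub M)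
        (fun _ => rfl) (fun _ _ s => .sub_right _ s) (.sub_right _)⟩
  | clo t v =>
    simp only [erase] at h
    cases h with
    | app t u v => exact ⟨.app (.clo t v) (.clo u v), rfl, ⟨hM, hM⟩, .inr ⟨rfl, .app _ _ _⟩⟩
    | lam t v =>
      exact ⟨.lam (.clo (t.rename sw) (v.rename Nat.succ)), rfl, DB.SN.shift hM,
        .inr ⟨by simp only [unfold, inst_sw]; rfl, .lam _ _⟩⟩
    | var1 v =>
      exact ⟨ofDB _, erase_ofDB _, good_ofDB _, .inr ⟨by rw [unfold_ofDB]; rfl, .var1 _⟩⟩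
    | gc t v =>
      exact ⟨ofDB _, erase_ofDB _, good_ofDB _,
        .inr ⟨by rw [unfold_ofDB, unfold, inst_shift], .gc _ _⟩⟩
    | sub_left u h => exact ⟨.clo _ v, rfl, hM, .inl (.single (h.subst _))⟩
    | sub_right t h =>
      refine ⟨.clo t _, rfl, DB.SN.step hM h, ?_⟩
      -- If the unfolding does not move, the step of `v` is charged to `Admin`.
      rcases reflTransGen_iff_eq_or_transGen.1 (Steps.inst_congr h t) with h' | h'
      · exact .inr ⟨h'.symm, .clo_right _ h⟩
      · exact .inl h'

/-- Lexicographic induction: first on the unfolding along nonempty reductions, then on `M` along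
`Admin`. -/
theorem Good.sn_erase {M : Marked} (hM : M.Good) (h : M.unfold.SN) : M.erase.SN := by
  have hT : Acc (TransGen fun a b => Step b a) M.unfold := h.transGen
  generalize hu : M.unfold = u at hT
  induction hT generalizing M with
  | intro u _ ihu =>
    have hA := hM.adminSN
    induction hA with
    | intro M _ ihA =>
      refine ⟨_, fun t' hs => ?_⟩
      obtain ⟨M', rfl, hg, hp | ⟨he, ha⟩⟩ := exists_progress hs hM
      · rw [← transGen_swap] at hp
        exact ihu M'.unfold (hu ▸ hp) hg (Acc.inv_of_transGen h hp) rfl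
      · exact ihA _ ha hg (he ▸ h) (he ▸ hu)

end Marked

/-! ### Reducibility -/

/-- Expansion of a substitution performed in head position into an explicit one. -/
inductive HeadExp : DB → DB → Prop
  | sub (t : DB) {u : DB} : u.SN → HeadExp (.sub t u) (inst u t)
  | app {t t' : DB} (u : DB) : HeadExp t t' → HeadExp (.app t u) (.app t' u)

/-- A single mark, on the head closure, relates the two terms. -/
theorem HeadExp.exists_marked {t t' : DB} (h : HeadExp t t') :
    ∃ M : Marked, M.erase = t ∧ M.unfold = t' ∧ M.Good := by
  induction h with
  | sub t h => exact ⟨.clo t _, rfl, rfl, h⟩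
  | app u _ ih =>
    obtain ⟨M, rfl, rfl, hg⟩ := ih
    exact ⟨.app M (.ofDB u), by simp [Marked.erase, Marked.erase_ofDB],
      by simp [Marked.unfold, Marked.unfold_ofDB], hg, Marked.good_ofDB u⟩

theorem HeadExp.sn {t t' : DB} (h : HeadExp t t') (ht : t'.SN) : t.SN := by
  obtain ⟨M, rfl, rfl, hg⟩ := h.exists_marked
  exact hg.sn_erase ht

/-- Expansion of a contracted head redex. -/
inductive BetaExp : DB → DB → Prop
  | beta (t u : DB) : BetaExp (.app (.lam t) u) (.sub t u)
  | app {t t' : DB} (u : DB) : BetaExp t t' → BetaExp (.app t u) (.app t' u)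

/-- The contractum keeps both parts of the redex, so any other step is mirrored there by exactly one
step; no hypothesis on the argument is needed. -/
theorem BetaExp.step {t t' s : DB} (h : BetaExp t t') (hs : Step t s) :
    s = t' ∨ ∃ s', Step t' s' ∧ BetaExp s s' := by
  induction h generalizing s with
  | beta t u =>
    cases hs with
    | beta => exact .inl rfl
    | app_left _ h =>
      cases h with
      | lam_congr h => exact .inr ⟨_, .sub_left _ h, .beta _ _⟩
    | app_right _ h => exact .inr ⟨_, .sub_right _ h, .beta _ _⟩
  | app u h ih =>
    cases hs with
    | beta => nomatch h
    | app_left _ hs =>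
      rcases ih hs with rfl | ⟨s', h1, h2⟩
      · exact .inl rfl
      · exact .inr ⟨_, .app_left _ h1, .app _ h2⟩
    | app_right _ hs => exact .inr ⟨_, .app_right _ hs, .app _ h⟩

theorem BetaExp.sn {t t' : DB} (h : BetaExp t t') (ht : t'.SN) : t.SN := by
  induction ht generalizing t with
  | intro t' ht ih =>
    refine ⟨_, fun s hs => ?_⟩
    rcases h.step hs with rfl | ⟨s', h1, h2⟩
    · exact ⟨_, ht⟩
    · exact ih _ h1 h2

/-- A variable applied to strongly normalizing terms. -/
inductive Neutral : DB → Prop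
  | var (n : ℕ) : Neutral (.var n)
  | app {t u : DB} : Neutral t → u.SN → Neutral (.app t u)

theorem Neutral.step {t t' : DB} (h : Neutral t) (s : Step t t') : Neutral t' := by
  induction h generalizing t' with
  | var n => nomatch s
  | app h hu ih =>
    cases s with
    | beta => nomatch h
    | app_left _ s => exact .app (ih s) hu
    | app_right _ s => exact .app h (hu.step s)

theorem Neutral.sn {t : DB} (h : Neutral t) : t.SN := by
  induction h with
  | var n => exact ⟨_, fun _ h => nomatch h⟩
  | @app t u h hu ih =>
    have key : ∀ t : DB, t.SN → ∀ u : DB, u.SN → Neutral t → (DB.app t u).SN := by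
      intro t ht
      induction ht with
      | intro t ht iht =>
        intro u hu hn
        induction hu with
        | intro u hu ihu =>
          refine ⟨_, fun s hs => ?_⟩
          cases hs with
          | beta => nomatch hn
          | app_left _ hs => exact iht _ hs _ ⟨_, hu⟩ (hn.step hs)
          | app_right _ hs => exact ihu _ hs
    exact key t ih u hu h

/-- Reducible terms of a type. -/
def Reducible : SimpleType → DB → Prop
  | .atom _, t => t.SN
  | .arrow A B, t => ∀ u, Reducible A u → Reducible B (.app t u)

theorem Reducible.sn_and_of_neutral (A : SimpleType) :
    (∀ t, Reducible A t → t.SN) ∧ ∀ t, Neutral t → Reducible A t := by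
  induction A with
  | atom n => exact ⟨fun _ h => h, fun _ h => h.sn⟩
  | arrow A B ihA ihB =>
    refine ⟨fun t h => ?_, fun t h u hu => ihB.2 _ (.app h (ihA.1 u hu))⟩
    -- The variable `var 0` is a reducible argument, and any reduction of `t` survives in `t`
    -- applied to it.
    exact DB.SN.of_map (F := fun t => .app t (.var 0)) (fun _ _ s => .app_left _ s)
      (ihB.1 _ (h _ (ihA.2 _ (.var 0))))

theorem Reducible.sn {A : SimpleType} {t : DB} (h : Reducible A t) : t.SN :=
  (sn_and_of_neutral A).1 t h

theorem Reducible.headExp {A : SimpleType} {t t' : DB} (h : HeadExp t t')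
    (ht : Reducible A t') : Reducible A t := by
  induction A generalizing t t' with
  | atom n => exact h.sn ht
  | arrow A B _ ihB => exact fun u hu => ihB (.app u h) (ht u hu)

theorem Reducible.betaExp {A : SimpleType} {t t' : DB} (h : BetaExp t t')
    (ht : Reducible A t') : Reducible A t := by
  induction A generalizing t t' with
  | atom n => exact h.sn ht
  | arrow A B _ ihB => exact fun u hu => ihB (.app u h) (ht u hu)

/-! ### Translation of named terms -/

open Term (fv swap)

/-- Extend an assignment of indices to names under a binder for `x`. -/
def bind (x : ℕ) (ρ : ℕ → ℕ) (y : ℕ) : ℕ := if y = x then 0 else ρ y + 1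

/-- The nameless term of a term, where the free variable `x` gets the index `ρ x`. -/
def toDB : Term → (ℕ → ℕ) → DB
  | .var x, ρ => .var (ρ x)
  | .app t u, ρ => .app (toDB t ρ) (toDB u ρ)
  | .lam x t, ρ => .lam (toDB t (bind x ρ))
  | .sub t x u, ρ => .sub (toDB t (bind x ρ)) (toDB u ρ)

theorem toDB_congr {t : Term} {ρ ρ' : ℕ → ℕ} (h : ∀ x ∈ fv t, ρ x = ρ' x) :
    toDB t ρ = toDB t ρ' := by
  have hb : ∀ (t : Term) (x : ℕ) (ρ ρ' : ℕ → ℕ), (∀ y ∈ (fv t).erase x, ρ y = ρ' y) →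
      ∀ y ∈ fv t, bind x ρ y = bind x ρ' y := by
    intro t x ρ ρ' h y hy
    unfold bind
    split_ifs with hyx
    · rfl
    · rw [h y (Finset.mem_erase.2 ⟨hyx, hy⟩)]
  induction t generalizing ρ ρ' with
  | var x => simp [toDB, h x (by simp [fv])]
  | app t u iht ihu =>
    simp only [toDB]
    rw [iht fun x hx => h x (Finset.mem_union_left _ hx),
      ihu fun x hx => h x (Finset.mem_union_right _ hx)]
  | lam x t ih =>
    simp only [toDB]
    rw [ih (hb t x ρ ρ' h)]
  | sub t x u iht ihu =>
    simp only [toDB]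
    rw [iht (hb t x ρ ρ' fun y hy => h y (Finset.mem_union_left _ hy)),
      ihu fun x hx => h x (Finset.mem_union_right _ hx)]

theorem bind_swap_comp (a b x : ℕ) (ρ : ℕ → ℕ) :
    bind (Equiv.swap a b x) ρ ∘ Equiv.swap a b = bind x (ρ ∘ Equiv.swap a b) := by
  funext y
  simp [bind]

theorem toDB_swap (a b : ℕ) (t : Term) (ρ : ℕ → ℕ) :
    toDB (swap a b t) ρ = toDB t (ρ ∘ Equiv.swap a b) := by
  induction t generalizing ρ <;> simp_all [toDB, swap, bind_swap_comp]

theorem toDB_rename_bound {x y : ℕ} {t : Term} (h : y ∉ fv t) (ρ : ℕ → ℕ) :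
    toDB (swap x y t) (bind y ρ) = toDB t (bind x ρ) := by
  rw [toDB_swap]
  apply toDB_congr
  intro z hz
  have hzy : z ≠ y := fun e => h (e ▸ hz)
  by_cases hzx : z = x
  · simp [bind, hzx]
  · simp [bind, Equiv.swap_apply_of_ne_of_ne hzx hzy, hzx, hzy]

theorem AlphaEq.toDB_eq {t t' : Term} (h : AlphaEq t t') (ρ : ℕ → ℕ) :
    toDB t ρ = toDB t' ρ := by
  induction h generalizing ρ with
  | lam_rename x y t h => simp [toDB, toDB_rename_bound h]
  | sub_rename x y t u h => simp [toDB, toDB_rename_bound h]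
  | refl => rfl
  | symm _ ih => exact (ih ρ).symm
  | trans _ _ ih ih' => exact (ih ρ).trans (ih' ρ)
  | app _ _ ih ih' => simp [toDB, ih ρ, ih' ρ]
  | lam x _ ih => simp [toDB, ih]
  | sub x _ _ ih ih' => simp [toDB, ih, ih']

theorem up_comp_bind (f : ℕ → ℕ) (x : ℕ) (ρ : ℕ → ℕ) : up f ∘ bind x ρ = bind x (f ∘ ρ) := by
  funext y
  by_cases h : y = x <;> simp [bind, h, up]

theorem rename_toDB (f : ℕ → ℕ) (t : Term) (ρ : ℕ → ℕ) :
    DB.rename f (toDB t ρ) = toDB t (f ∘ ρ) := by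
  induction t generalizing f ρ <;> simp_all [toDB, DB.rename, up_comp_bind]

theorem sw_comp_bind {x y : ℕ} (h : x ≠ y) (ρ : ℕ → ℕ) :
    sw ∘ bind x (bind y ρ) = bind y (bind x ρ) := by
  funext z
  by_cases hx : z = x
  · simp [bind, hx, h, sw]
  · by_cases hy : z = y
    · simp [bind, hy, h.symm, sw]
    · simp [bind, hx, hy, sw]

theorem shift_toDB {x : ℕ} {u : Term} (h : x ∉ fv u) (ρ : ℕ → ℕ) :
    DB.rename Nat.succ (toDB u ρ) = toDB u (bind x ρ) := by
  rw [rename_toDB]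
  apply toDB_congr
  intro z hz
  have : z ≠ x := fun e => h (e ▸ hz)
  simp [bind, this]

/-- In the rule Lambda, `x ≠ y` makes the exchange of the two binders correct, and `x ∉ fv u` makes
the shift of `u` correct. -/
theorem Rule.toDB_step {t t' : Term} (h : Rule t t') (ρ : ℕ → ℕ) :
    Step (toDB t ρ) (toDB t' ρ) := by
  cases h with
  | beta h =>
    cases h with
    | beta x t u => exact .beta _ _
  | app t u x v => exact .app _ _ _
  | lam x t y u hxy hx =>
    have h := Step.lam (toDB t (bind x (bind y ρ))) (toDB u ρ)
    rw [rename_toDB, sw_comp_bind hxy, shift_toDB hx] at h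
    exact h
  | var1 x t =>
    simp only [toDB, bind, if_true]
    exact .var1 _
  | var2 x y t hxy =>
    simp only [toDB, bind, if_neg hxy]
    exact .gc (.var (ρ y)) _

-- The assignment `ρ` is arbitrary because it changes at each binder crossed.
theorem Compat.toDB_step {t t' : Term} (h : Compat Rule t t') (ρ : ℕ → ℕ) :
    Step (toDB t ρ) (toDB t' ρ) := by
  induction h generalizing ρ with
  | root h => exact h.toDB_step ρ
  | app_left u _ ih => exact .app_left _ (ih ρ)
  | app_right t _ ih => exact .app_right _ (ih ρ)
  | lam x _ ih => exact .lam_congr (ih _)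
  | sub_left x u _ ih => exact .sub_left _ (ih _)
  | sub_right t x _ ih => exact .sub_right _ (ih _)

theorem Red.toDB_step {t t' : Term} (h : Red t t') (ρ : ℕ → ℕ) :
    Step (toDB t ρ) (toDB t' ρ) := by
  obtain ⟨s, s', h1, h2, h3⟩ := h
  rw [h1.toDB_eq, ← h3.toDB_eq]
  exact h2.toDB_step ρ

theorem SN.of_toDB {t : Term} {ρ : ℕ → ℕ} (h : (toDB t ρ).SN) : SN t := by
  rintro ⟨f, rfl, hf⟩
  have key : ∀ s : DB, s.SN → ∀ n, toDB (f n) ρ ≠ s := by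
    intro s hs
    induction hs with
    | intro s _ ih =>
      rintro n rfl
      exact ih _ ((hf n).toDB_step ρ) (n + 1) rfl
  exact key _ h 0 rfl

/-! ### The fundamental lemma of reducibility -/

theorem reducible_cons {Γ : Context} {x : ℕ} {A : SimpleType} {u : DB} {ρ : ℕ → ℕ}
    {σ : ℕ → DB} (h : ∀ y B, Γ y = some B → Reducible B (σ (ρ y))) (hu : Reducible A u) :
    ∀ y B, Γ.extend x A y = some B → Reducible B (cons u σ (bind x ρ y)) := by
  intro y B hy
  by_cases hyx : y = x
  · subst hyx
    simp only [Context.extend, Function.update_self, Option.some.injEq] at hy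
    subst hy
    simpa [bind, cons] using hu
  · rw [Context.extend, Function.update_of_ne hyx] at hy
    simpa [bind, hyx, cons] using h y B hy

theorem Typing.reducible {Γ : Context} {t : Term} {A : SimpleType} (h : Typing Γ t A)
    (ρ : ℕ → ℕ) (σ : ℕ → DB) (hσ : ∀ x B, Γ x = some B → Reducible B (σ (ρ x))) :
    Reducible A (DB.subst σ (toDB t ρ)) := by
  induction h generalizing ρ σ with
  | var h => exact hσ _ _ h
  | app _ _ iht ihu => exact iht ρ σ hσ _ (ihu ρ σ hσ)
  | lam _ ih =>
    intro u hu
    -- Two expansions: from the performed substitution to the closure, then to the redex; `hu.sn` is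
    -- what the former requires.
    refine .betaExp (.beta _ _) (.headExp (.sub _ hu.sn) ?_)
    rw [inst_subst_ups]
    exact ih _ _ (reducible_cons hσ hu)
  | sub _ _ ihu iht =>
    have hu := ihu ρ σ hσ
    refine .headExp (.sub _ hu.sn) ?_
    rw [inst_subst_ups]
    exact iht _ _ (reducible_cons hσ hu)

theorem Typing.sn {Γ : Context} {t : Term} {A : SimpleType} (h : Typing Γ t A) : SN t := by
  -- Variables are neutral, hence reducible, so the identity substitution is admissible.
  have hr := h.reducible id DB.var fun _ B _ => (Reducible.sn_and_of_neutral B).2 _ (.var _)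
  rw [subst_var] at hr
  exact SN.of_toDB hr.sn

/-! ### The expansion `ateb` -/

theorem Term.isPure_ateb (t : Term) : t.ateb.IsPure := by
  induction t <;> simp_all [ateb, IsPure]

theorem Typing.ateb {Γ : Context} {t : Term} {A : SimpleType} (h : Typing Γ t A) :
    Typing Γ t.ateb A := by
  induction h with
  | var h => exact .var h
  | app _ _ iht ihu => exact .app iht ihu
  | lam _ ih => exact .lam ih
  | sub _ _ ihu iht => exact .app (.lam iht) ihu

theorem BetaRed.of_compat {t t' : Term} (h : Compat BetaRule t t') : BetaRed t t' :=
  ⟨t, t', .refl t, h, .refl t'⟩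

theorem betaRed_app {t t' u u' : Term} (h : ReflTransGen BetaRed t t')
    (k : ReflTransGen BetaRed u u') : ReflTransGen BetaRed (.app t u) (.app t' u') := by
  refine (reflTransGen_map (fun x => Term.app x u) ?_ h).trans
    (reflTransGen_map (Term.app t') ?_ k)
  · rintro _ _ ⟨s, s', h1, h2, h3⟩
    exact ⟨_, _, .app h1 (.refl u), .app_left u h2, .app h3 (.refl u)⟩
  · rintro _ _ ⟨s, s', h1, h2, h3⟩
    exact ⟨_, _, .app (.refl t') h1, .app_right t' h2, .app (.refl t') h3⟩

theorem betaRed_lam (x : ℕ) {t t' : Term} (h : ReflTransGen BetaRed t t') :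
    ReflTransGen BetaRed (.lam x t) (.lam x t') := by
  refine reflTransGen_map (Term.lam x) ?_ h
  rintro _ _ ⟨s, s', h1, h2, h3⟩
  exact ⟨_, _, .lam x h1, .lam x h2, .lam x h3⟩

theorem Term.ateb_betaRed (t : Term) : ReflTransGen BetaRed t.ateb t := by
  induction t with
  | var x => exact .refl
  | app t u iht ihu => exact betaRed_app iht ihu
  | lam x t ih => exact betaRed_lam x ih
  | sub t x u iht ihu =>
    exact (betaRed_app (betaRed_lam x iht) ihu).tail (.of_compat (.root (.beta x t u)))

end LambdaX

theorem mainTheorem4 :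
    (∀ t : LambdaX.Term, t.ateb.IsPure) ∧
    (∀ (Γ : LambdaX.Context) (t : LambdaX.Term) (A : LambdaX.SimpleType),
      LambdaX.Typing Γ t A → LambdaX.Typing Γ t.ateb A) ∧
    (∀ t : LambdaX.Term, Relation.ReflTransGen LambdaX.BetaRed t.ateb t) ∧
    (∀ (Γ : LambdaX.Context) (t : LambdaX.Term) (A : LambdaX.SimpleType),
      LambdaX.Typing Γ t A → LambdaX.SN t) :=
  ⟨LambdaX.Term.isPure_ateb, fun _ _ _ h => h.ateb, LambdaX.Term.ateb_betaRed,
    fun _ _ _ h => h.sn⟩
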